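/- Let $k$ be an algebraically closed field of characteristic $0$, let $A$ be a finitely generated associative unital $k$-algebra, and let $(e_s)_{s\in I}$ be a finite complete set of orthogonal idempotents of $A$ (so $e_se_t=\delta_{st}e_s$ and $\sum_s e_s=1$); put $B=\sum_s k\,e_s\subset A$, $\otimes=\otimes_k$, and write $d=d'\otimes d''$ for elements of $A\otimes A$ (Sweedler notation). Let $\{\!\{-,-\}\!\}:A\times A\to A\otimes A$ be a $B$-linear double bracket, i.e. a $k$-bilinear map, vanishing when one of its arguments lies in $B$, such that $\{\!\{a,b\}\!\}=-\{\!\{b,a\}\!\}''\otimes\{\!\{b,a\}\!\}'$ and $$\{\!\{a,bc\}\!\}=\{\!\{a,b\}\!\}'\otimes\{\!\{a,b\}\!\}''c+b\{\!\{a,c\}\!\}'\otimes\{\!\{a,c\}\!\}''.$$ With $\tau(a_1\otimes a_2\otimes a_3)=a_3\otimes a_1\otimes a_2$, set $$\{\!\{a,b,c\}\!\}=\{\!\{a,\{\!\{b,c\}\!\}'\}\!\}\otimes\{\!\{b,c\}\!\}''+\tau\big(\{\!\{b,\{\!\{c,a\}\!\}'\}\!\}\otimes\{\!\{c,a\}\!\}''\big)+\tau^2\big(\{\!\{c,\{\!\{a,b\}\!\}'\}\!\}\otimes\{\!\{a,b\}\!\}''\big),$$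 and assume that $(A,\{\!\{-,-\}\!\})$ is a double quasi-Poisson algebra over $B$, i.e. for all $a,b,c\in A$ $$\begin{aligned}\{\!\{a,b,c\}\!\}=\tfrac14\sum_{s\in I}\Big(&ce_sa\otimes e_sb\otimes e_s-ce_sa\otimes e_s\otimes be_s-ce_s\otimes ae_sb\otimes e_s+ce_s\otimes ae_s\otimes be_s\\&-e_sa\otimes e_sb\otimes e_sc+e_sa\otimes e_s\otimes be_sc+e_s\otimes ae_sb\otimes e_sc-e_s\otimes ae_s\otimes be_sc\Big).\end{aligned}$$ Let $\alpha\in\mathbb N^I$, $N=\sum_s\alpha_s$, and let $R=\mathcal O(\mathrm{Rep}(A,\alpha))$ be the commutative $k$-algebra generated by symbols $a_{ij}$ ($a\in A$, $1\le i,j\le N$) subject to: $a\mapsto X(a)=(a_{ij})_{ij}$ is $k$-linear, $X(ab)=X(a)X(b)$, and $X(e_s)$ is the $s$-th diagonal identity block (of size $\alpha_s$). The group $\mathrm{GL}_\alpha=\prod_s\mathrm{GL}_{\alpha_s}(k)$, embedded block-diagonally, acts on $R$ by $k$-algebra automorphisms through $g\cdot X(a)=g^{-1}X(a)g$. Then there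 is a unique antisymmetric $k$-bilinear biderivation $\{-,-\}$ on $R$ (the quasi-Poisson bracket on $R$) such that $$\{a_{ij},b_{uv}\}=\{\!\{a,b\}\!\}'_{uj}\,\{\!\{a,b\}\!\}''_{iv}\qquad(a,b\in A,\ 1\le i,j,u,v\le N),$$ and it restricts to a Poisson bracket on the algebra of invariants $R^{\mathrm{GL}_\alpha}=\mathcal O(\mathrm{Rep}(A,\alpha)/\!/\mathrm{GL}_\alpha)$: for $f,g\in R^{\mathrm{GL}_\alpha}$ one has $\{f,g\}\in R^{\mathrm{GL}_\alpha}$, and $\{-,-\}$ makes $R^{\mathrm{GL}_\alpha}$ a Poisson algebra (an antisymmetric biderivation satisfying the Jacobi identity). -/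

import Mathlib

open scoped TensorProduct

/-- A double bracket on a `k`-algebra `A`, linear over `B = ⊕ₛ k eₛ`: a `k`-bilinear map
`⦃-,-⦄ : A × A → A ⊗ A` which is cyclically antisymmetric, is a derivation in its second argument
for the outer bimodule structure `b (x ⊗ y) c = b x ⊗ y c`, and vanishes as soon as one of its
arguments lies in `B` (equivalently, by `k`-bilinearity, is one of the `eₛ`). -/
structure DoubleBracket (k : Type*) [Field k] (A : Type*) [Ring A] [Algebra k A]
    {I : Type*} (e : I → A) where
  br : A →ₗ[k] A →ₗ[k] A ⊗[k] A
  antisymm : ∀ a b, br a b = - TensorProduct.comm k A A (br b a)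
  leibniz : ∀ a b c, br a (b * c) =
    LinearMap.lTensor A (LinearMap.mulRight k c) (br a b) +
      LinearMap.rTensor A (LinearMap.mulLeft k b) (br a c)
  idem_left : ∀ s a, br (e s) a = 0
  idem_right : ∀ a s, br a (e s) = 0

namespace DoubleBracket

/-- The cyclic permutation `a₁ ⊗ a₂ ⊗ a₃ ↦ a₃ ⊗ a₁ ⊗ a₂`. -/
noncomputable def cyc (k : Type*) [Field k] (A : Type*) [Ring A] [Algebra k A] :
    (A ⊗[k] A) ⊗[k] A →ₗ[k] (A ⊗[k] A) ⊗[k] A :=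
  (TensorProduct.assoc k A A A).symm.toLinearMap ∘ₗ
    (TensorProduct.comm k (A ⊗[k] A) A).toLinearMap

theorem cyc_tmul (k : Type*) [Field k] (A : Type*) [Ring A] [Algebra k A] (x y z : A) :
    cyc k A (x ⊗ₜ[k] y ⊗ₜ[k] z) = z ⊗ₜ[k] x ⊗ₜ[k] y := rfl

variable {k : Type*} [Field k] {A : Type*} [Ring A] [Algebra k A] {I : Type*} {e : I → A}

/-- `⦃a, d'⦄ ⊗ d''` for `d = d' ⊗ d''`. -/
noncomputable def nested (D : DoubleBracket k A e) (a : A) :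
    A ⊗[k] A →ₗ[k] (A ⊗[k] A) ⊗[k] A :=
  LinearMap.rTensor A (D.br a)

/-- The triple bracket `⦃a,b,c⦄` associated with a double bracket. -/
noncomputable def triple (D : DoubleBracket k A e) (a b c : A) : (A ⊗[k] A) ⊗[k] A :=
  D.nested a (D.br b c) + cyc k A (D.nested b (D.br c a)) +
    cyc k A (cyc k A (D.nested c (D.br a b)))

/-- A double bracket is quasi-Poisson if its triple bracket is the one defined by the gauge
elements `E_s : a ↦ a e_s ⊗ e_s - e_s ⊗ e_s a`, i.e. by `(1/12) ∑ₛ E_s³`, written out. -/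
def IsQuasiPoisson [Fintype I] (D : DoubleBracket k A e) : Prop :=
  ∀ a b c : A, D.triple a b c = (1 / 4 : k) • ∑ s,
    ((c * e s * a) ⊗ₜ[k] (e s * b) ⊗ₜ[k] e s
      - (c * e s * a) ⊗ₜ[k] e s ⊗ₜ[k] (b * e s)
      - (c * e s) ⊗ₜ[k] (a * e s * b) ⊗ₜ[k] e s
      + (c * e s) ⊗ₜ[k] (a * e s) ⊗ₜ[k] (b * e s)
      - (e s * a) ⊗ₜ[k] (e s * b) ⊗ₜ[k] (e s * c)
      + (e s * a) ⊗ₜ[k] e s ⊗ₜ[k] (b * e s * c)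
      + e s ⊗ₜ[k] (a * e s * b) ⊗ₜ[k] (e s * c)
      - e s ⊗ₜ[k] (a * e s) ⊗ₜ[k] (b * e s * c))

end DoubleBracket

/-- The index set `{1, …, N}`, `N = ∑ₛ αₛ`, cut into consecutive blocks of sizes `αₛ`. -/
abbrev RepIdx {I : Type*} (α : I → ℕ) : Type _ := (s : I) × Fin (α s)

/-- The diagonal matrix whose `s`-th diagonal block is the identity and which is `0` elsewhere. -/
def blockId {I : Type*} [DecidableEq I] (α : I → ℕ) (S : Type*) [CommRing S] (s : I) :
    Matrix (RepIdx α) (RepIdx α) S :=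
  Matrix.diagonal fun i => if i.1 = s then 1 else 0

section RepRing

variable (k : Type*) [Field k] {A : Type*} [Ring A] [Algebra k A]
  {I : Type*} [Fintype I] [DecidableEq I] (e : I → A) (α : I → ℕ)

/-- The polynomial variable `a_{ij}`. -/
noncomputable def RepRing.var (a : A) (i j : RepIdx α) :
    MvPolynomial (A × RepIdx α × RepIdx α) k :=
  MvPolynomial.X (a, i, j)

/-- The defining relations of the coordinate ring of `Rep(A, α)`: the matrices `(a_{ij})` depend
`k`-linearly and multiplicatively on `a`, and `eₛ` is sent to the `s`-th identity block. -/
inductive RepRing.Rel : MvPolynomial (A × RepIdx α × RepIdx α) k → Prop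
  | add (a b : A) (i j : RepIdx α) :
      Rel (var k α (a + b) i j - (var k α a i j + var k α b i j))
  | smul (r : k) (a : A) (i j : RepIdx α) :
      Rel (var k α (r • a) i j - MvPolynomial.C r * var k α a i j)
  | mul (a b : A) (i j : RepIdx α) :
      Rel (var k α (a * b) i j - ∑ m, var k α a i m * var k α b m j)
  | idem (s : I) (i j : RepIdx α) :
      Rel (var k α (e s) i j - blockId α (MvPolynomial (A × RepIdx α × RepIdx α) k) s i j)

/-- The coordinate ring `O(Rep(A, α))` of the scheme of representations of `A` of dimension
vector `α`, relative to `B = ⊕ₛ k eₛ`. -/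
abbrev RepRing : Type _ :=
  MvPolynomial (A × RepIdx α × RepIdx α) k ⧸ Ideal.span {p | RepRing.Rel k e α p}

namespace RepRing

/-- The universal matrix `X(a) = (a_{ij})`. -/
noncomputable def X (a : A) : Matrix (RepIdx α) (RepIdx α) (RepRing k e α) :=
  Matrix.of fun i j => Ideal.Quotient.mk _ (var k α a i j)

variable {k e α} in
theorem mk_eq_zero_of_rel {p : MvPolynomial (A × RepIdx α × RepIdx α) k} (h : Rel k e α p) :
    Ideal.Quotient.mk (Ideal.span {p | Rel k e α p}) p = 0 :=
  Ideal.Quotient.eq_zero_iff_mem.mpr (Ideal.subset_span h)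

theorem X_add (a b : A) : X k e α (a + b) = X k e α a + X k e α b := by
  ext i j
  have h := mk_eq_zero_of_rel (Rel.add (k := k) (e := e) (α := α) a b i j)
  rw [map_sub, sub_eq_zero, map_add] at h
  exact h

theorem X_smul (r : k) (a : A) : X k e α (r • a) = r • X k e α a := by
  ext i j
  have h := mk_eq_zero_of_rel (Rel.smul (k := k) (e := e) (α := α) r a i j)
  rw [map_sub, sub_eq_zero, map_mul] at h
  rw [Matrix.smul_apply, Algebra.smul_def (A := RepRing k e α)]
  exact h

theorem X_mul (a b : A) : X k e α (a * b) = X k e α a * X k e α b := by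
  ext i j
  have h := mk_eq_zero_of_rel (Rel.mul (k := k) (e := e) (α := α) a b i j)
  rw [map_sub, sub_eq_zero, map_sum] at h
  rw [Matrix.mul_apply]
  simp only [map_mul] at h
  exact h

theorem X_idem (s : I) : X k e α (e s) = blockId α (RepRing k e α) s := by
  ext i j
  have h := mk_eq_zero_of_rel (Rel.idem (k := k) (e := e) (α := α) s i j)
  rw [map_sub, sub_eq_zero] at h
  refine Eq.trans h ?_
  simp only [blockId, Matrix.diagonal_apply]
  split_ifs <;> simp

/-- The function `a ↦ a_{ij}` as a linear map. -/
noncomputable def entry (i j : RepIdx α) : A →ₗ[k] RepRing k e α where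
  toFun a := X k e α a i j
  map_add' a b := by rw [X_add]; rfl
  map_smul' r a := by rw [X_smul]; rfl

/-- The linear map `a' ⊗ a'' ↦ a'_{ij} a''_{uv}`. -/
noncomputable def entry₂ (i j u v : RepIdx α) : A ⊗[k] A →ₗ[k] RepRing k e α :=
  LinearMap.mul' k (RepRing k e α) ∘ₗ TensorProduct.map (entry k e α i j) (entry k e α u v)

theorem entry₂_tmul (i j u v : RepIdx α) (x y : A) :
    entry₂ k e α i j u v (x ⊗ₜ y) = X k e α x i j * X k e α y u v := by
  simp [entry₂, entry]

/-- The algebra map `O(Rep(A, α)) → S` defined by an `S`-point of `Rep(A, α)`. -/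
noncomputable def lift {S : Type*} [CommRing S] [Algebra k S]
    (ρ : A → Matrix (RepIdx α) (RepIdx α) S)
    (hadd : ∀ a b, ρ (a + b) = ρ a + ρ b) (hsmul : ∀ (r : k) a, ρ (r • a) = r • ρ a)
    (hmul : ∀ a b, ρ (a * b) = ρ a * ρ b) (hidem : ∀ s, ρ (e s) = blockId α S s) :
    RepRing k e α →ₐ[k] S :=
  Ideal.Quotient.liftₐ (Ideal.span {p | Rel k e α p})
    (MvPolynomial.aeval fun x : A × RepIdx α × RepIdx α => ρ x.1 x.2.1 x.2.2) (by
      intro p hp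
      rw [← RingHom.mem_ker]
      revert p
      change Ideal.span _ ≤ RingHom.ker _
      rw [Ideal.span_le]
      rintro p hp
      rw [SetLike.mem_coe, RingHom.mem_ker]
      cases hp with
      | add a b i j => simp [var, hadd]
      | smul r a i j =>
        simp only [var, map_sub, map_mul, MvPolynomial.aeval_X, hsmul, MvPolynomial.aeval_C,
          Matrix.smul_apply, Algebra.smul_def (A := S), sub_self]
      | mul a b i j => simp [var, hmul, Matrix.mul_apply]
      | idem s i j =>
        simp only [var, map_sub, MvPolynomial.aeval_X, hidem, blockId, Matrix.diagonal_apply]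
        split_ifs <;> simp)

theorem lift_X {S : Type*} [CommRing S] [Algebra k S]
    (ρ : A → Matrix (RepIdx α) (RepIdx α) S)
    (hadd : ∀ a b, ρ (a + b) = ρ a + ρ b) (hsmul : ∀ (r : k) a, ρ (r • a) = r • ρ a)
    (hmul : ∀ a b, ρ (a * b) = ρ a * ρ b) (hidem : ∀ s, ρ (e s) = blockId α S s)
    (a : A) (i j : RepIdx α) :
    lift k e α ρ hadd hsmul hmul hidem (X k e α a i j) = ρ a i j := by
  change MvPolynomial.aeval _ (var k α a i j) = _
  simp [var]

variable {k e α} in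
theorem algHom_ext {S : Type*} [CommRing S] [Algebra k S] {f g : RepRing k e α →ₐ[k] S}
    (h : ∀ a i j, f (X k e α a i j) = g (X k e α a i j)) : f = g := by
  apply Ideal.Quotient.algHom_ext
  apply MvPolynomial.algHom_ext
  rintro ⟨a, i, j⟩
  exact h a i j

/-- The group `GL_α = ∏ₛ GL_{αₛ}(k)`. -/
abbrev GLα : Type _ := ∀ s, GL (Fin (α s)) k

/-- The block diagonal matrix of an element of `GL_α`, with entries in `O(Rep(A, α))`. -/
noncomputable def glMat :
    GLα k α →* Matrix (RepIdx α) (RepIdx α) (RepRing k e α) where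
  toFun g := (Matrix.blockDiagonal' fun s => (g s : Matrix (Fin (α s)) (Fin (α s)) k)).map
    (algebraMap k (RepRing k e α))
  map_one' := by
    have : (fun s => (((1 : GLα k α) s : GL (Fin (α s)) k) :
        Matrix (Fin (α s)) (Fin (α s)) k)) = 1 := by
      funext s; rfl
    rw [this, Matrix.blockDiagonal'_one, Matrix.map_one _ (map_zero _) (map_one _)]
  map_mul' g h := by
    rw [← Matrix.map_mul, ← Matrix.blockDiagonal'_mul]
    rfl

theorem glMat_comm_blockId (g : GLα k α) (s : I) :
    glMat k e α g * blockId α (RepRing k e α) s = blockId α (RepRing k e α) s * glMat k e α g := by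
  ext i j
  rw [blockId, Matrix.mul_diagonal, Matrix.diagonal_mul]
  obtain ⟨p, i⟩ := i
  obtain ⟨q, j⟩ := j
  by_cases h : p = q
  · subst h
    exact mul_comm _ _
  · have : glMat k e α g ⟨p, i⟩ ⟨q, j⟩ = 0 := by
      change algebraMap k (RepRing k e α) (Matrix.blockDiagonal'
        (fun s => (g s : Matrix (Fin (α s)) (Fin (α s)) k)) ⟨p, i⟩ ⟨q, j⟩) = 0
      rw [Matrix.blockDiagonal'_apply_ne _ _ _ h, map_zero]
    rw [this, zero_mul, mul_zero]

theorem glMat_inv_mul (g : GLα k α) : glMat k e α g⁻¹ * glMat k e α g = 1 := by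
  rw [← map_mul, inv_mul_cancel, map_one]

theorem glMat_mul_inv (g : GLα k α) : glMat k e α g * glMat k e α g⁻¹ = 1 := by
  rw [← map_mul, mul_inv_cancel, map_one]

/-- The automorphism of `O(Rep(A, α))` given by `g`, in matrix notation `g • X(a) = g⁻¹ X(a) g`. -/
noncomputable def glHom (g : GLα k α) : RepRing k e α →ₐ[k] RepRing k e α :=
  lift k e α (fun a => glMat k e α g⁻¹ * X k e α a * glMat k e α g)
    (fun a b => by rw [X_add, mul_add, add_mul])
    (fun r a => by rw [X_smul, Matrix.mul_smul, Matrix.smul_mul])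
    (fun a b => by
      rw [X_mul]
      calc _ = glMat k e α g⁻¹ * X k e α a * 1 * X k e α b * glMat k e α g := by
            simp only [mul_assoc, one_mul]
        _ = _ := by rw [← glMat_mul_inv k e α g]; simp only [mul_assoc])
    (fun s => by
      rw [X_idem, mul_assoc, ← glMat_comm_blockId, ← mul_assoc, glMat_inv_mul, one_mul])

theorem glHom_X (g : GLα k α) (a : A) (i j : RepIdx α) :
    glHom k e α g (X k e α a i j) = (glMat k e α g⁻¹ * X k e α a * glMat k e α g) i j :=
  lift_X ..

theorem glHom_map_X (g : GLα k α) (a : A) :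
    (X k e α a).map (glHom k e α g) = glMat k e α g⁻¹ * X k e α a * glMat k e α g := by
  ext i j
  exact glHom_X ..

theorem glMat_map (g : GLα k α) (φ : RepRing k e α →ₐ[k] RepRing k e α) :
    (glMat k e α g).map φ = glMat k e α g := by
  ext i j
  exact φ.commutes _

/-- The left action of `GL_α` on `O(Rep(A, α))` by algebra automorphisms. -/
noncomputable def glAction : GLα k α →* (RepRing k e α →ₐ[k] RepRing k e α) where
  toFun := glHom k e α
  map_one' := algHom_ext fun a i j => by
    rw [glHom_X, inv_one, map_one, one_mul, mul_one]; rfl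
  map_mul' g h := algHom_ext fun a i j => by
    rw [glHom_X, AlgHom.mul_apply, glHom_X, ← Matrix.map_apply (f := glHom k e α g),
      Matrix.map_mul, Matrix.map_mul, glMat_map, glMat_map, glHom_map_X, mul_inv_rev,
      map_mul, map_mul]
    simp only [mul_assoc]

/-- The subalgebra `O(Rep(A, α))^{GL_α} = O(Rep(A, α) // GL_α)` of invariant functions. -/
def invariants : Subalgebra k (RepRing k e α) where
  carrier := {f | ∀ g, glAction k e α g f = f}
  mul_mem' ha hb g := by rw [map_mul, ha g, hb g]
  add_mem' ha hb g := by rw [map_add, ha g, hb g]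
  algebraMap_mem' r g := AlgHom.commutes _ r

end RepRing

end RepRing

/-- An antisymmetric biderivation on a commutative `k`-algebra. -/
structure IsAntisymmBiderivation {k R : Type*} [Field k] [CommRing R] [Algebra k R]
    (br : R →ₗ[k] R →ₗ[k] R) : Prop where
  antisymm : ∀ f g, br f g = - br g f
  leibniz : ∀ f g h, br f (g * h) = br f g * h + g * br f h

/-- A Poisson bracket on a commutative `k`-algebra: an antisymmetric biderivation which satisfies
the Jacobi identity. -/
structure IsPoissonBracket {k R : Type*} [Field k] [CommRing R] [Algebra k R]
    (br : R →ₗ[k] R →ₗ[k] R) : Prop extends IsAntisymmBiderivation br where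
  jacobi : ∀ f g h, br f (br g h) + br g (br h f) + br h (br f g) = 0

/-- `br` is the bracket on `O(Rep(A, α))` defined by the double bracket `D`: the antisymmetric
biderivation with `{a_{ij}, b_{uv}} = ⦃a,b⦄'_{uj} ⦃a,b⦄''_{iv}`. -/
structure DoubleBracket.IsRepBracket {k : Type*} [Field k] {A : Type*} [Ring A] [Algebra k A]
    {I : Type*} [Fintype I] [DecidableEq I] {e : I → A} (D : DoubleBracket k A e) (α : I → ℕ)
    (br : RepRing k e α →ₗ[k] RepRing k e α →ₗ[k] RepRing k e α) : Prop
    extends IsAntisymmBiderivation br where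
  apply_X : ∀ (a b : A) (i j u v : RepIdx α),
    br (RepRing.X k e α a i j) (RepRing.X k e α b u v) =
      RepRing.entry₂ k e α u j i v (D.br a b)

/-! Write R for `RepRing k e α`. An algebra map out of R is a point of Rep(A, α), so a derivation of
R is the same as a point over the dual numbers, and it can be prescribed on the a_{ij} as soon as it
respects products in A and kills the e_s. Applying this twice, with values in R and then in Der(R),
produces the bracket; uniqueness holds because the a_{ij} generate R.

For Jacobi, the Jacobiator of an antisymmetric biderivation is a derivation in each argument. On
generators it is a difference of two entries of triple brackets (`IsRepBracket.jacobiator_X`). The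
quasi-Poisson identity says that such an entry, as a function of a, is an entry of [X(a), M] with M
a block diagonal matrix over R that does not depend on a (`IsQuasiPoisson.exists_commutator`). So
the Jacobiator with two generators fixed is an infinitesimal conjugation, and these kill invariants
(`adDerivation_of_mem_invariants`).

That last fact is obtained without differentiating a group action: conjugation by 1 + (T - 1)e_{pq}
fixes an invariant f at every T = t in kˣ, hence identically in R[T;T⁻¹], and T = 1 + ε then
extracts the derivative. -/

namespace RepRing

variable {k : Type*} [Field k] {A : Type*} [Ring A] [Algebra k A]
  {I : Type*} [Fintype I] [DecidableEq I] {e : I → A} {α : I → ℕ}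

/-! ### Derivations of the coordinate ring prescribed on generators. -/

section Derivations

theorem adjoin_X_eq_top :
    Algebra.adjoin k {f : RepRing k e α | ∃ a i j, f = X k e α a i j} = ⊤ := by
  set S := Algebra.adjoin k {f : RepRing k e α | ∃ a i j, f = X k e α a i j}
  -- `φ` factors through the subalgebra `S` and fixes every generator, so it is the identity and `S`
  -- is everything.
  let φ : RepRing k e α →ₐ[k] RepRing k e α := S.val.comp
    (Ideal.Quotient.liftₐ (Ideal.span {p | Rel k e α p})
      (MvPolynomial.aeval fun x : A × RepIdx α × RepIdx α =>
        (⟨X k e α x.1 x.2.1 x.2.2, Algebra.subset_adjoin ⟨_, _, _, rfl⟩⟩ : S)) (by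
        intro p hp
        apply Subtype.val_injective
        have : (S.val.comp (MvPolynomial.aeval fun x : A × RepIdx α × RepIdx α =>
            (⟨X k e α x.1 x.2.1 x.2.2, Algebra.subset_adjoin ⟨_, _, _, rfl⟩⟩ : S))) =
            Ideal.Quotient.mkₐ k (Ideal.span {p | Rel k e α p}) := by
          apply MvPolynomial.algHom_ext
          rintro ⟨a, i, j⟩
          simp only [AlgHom.comp_apply, MvPolynomial.aeval_X]
          rfl
        exact (DFunLike.congr_fun this p).trans (Ideal.Quotient.eq_zero_iff_mem.mpr hp)))
  have hφ : φ = AlgHom.id k _ := algHom_ext fun a i j => by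
    change ((MvPolynomial.aeval _ (var k α a i j) : S) : RepRing k e α) = _
    simp [var]
  refine eq_top_iff.mpr fun f _ => ?_
  have : φ f = f := by rw [hφ]; rfl
  rw [← this]
  exact Subtype.property _

theorem derivation_sum_apply {R M ι : Type*} [CommRing R] [Algebra k R] [AddCommGroup M]
    [Module k M] [Module R M] (s : Finset ι) (d : ι → Derivation k R M) (f : R) :
    (∑ i ∈ s, d i) f = ∑ i ∈ s, d i f := by
  change Derivation.coeFnAddMonoidHom (∑ i ∈ s, d i) f = _
  rw [map_sum, Finset.sum_apply]
  rfl

@[elab_as_elim]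
theorem induction_X {p : RepRing k e α → Prop} (f : RepRing k e α)
    (hX : ∀ a i j, p (X k e α a i j)) (hC : ∀ r : k, p (algebraMap k _ r))
    (hadd : ∀ f g, p f → p g → p (f + g)) (hmul : ∀ f g, p f → p g → p (f * g)) : p f := by
  have hf : f ∈ Algebra.adjoin k {f : RepRing k e α | ∃ a i j, f = X k e α a i j} := by
    rw [adjoin_X_eq_top]; trivial
  induction hf using Algebra.adjoin_induction with
  | mem x hx => obtain ⟨a, i, j, rfl⟩ := hx; exact hX a i j
  | algebraMap r => exact hC r
  | add x y _ _ hx hy => exact hadd x y hx hy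
  | mul x y _ _ hx hy => exact hmul x y hx hy

variable {M : Type*} [AddCommGroup M] [Module k M] [Module (RepRing k e α) M]

theorem derivation_ext {d₁ d₂ : Derivation k (RepRing k e α) M}
    (h : ∀ a i j, d₁ (X k e α a i j) = d₂ (X k e α a i j)) : d₁ = d₂ :=
  Derivation.ext_of_adjoin_eq_top _ adjoin_X_eq_top (by rintro _ ⟨a, i, j, rfl⟩; exact h a i j)

-- `hmul` and `hidem` are the ε-parts of the defining relations over R ⊕ εM. The module stays
-- general because M = R and M = Der(R) are both needed.
variable [IsScalarTower k (RepRing k e α) M]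
  [Module (RepRing k e α)ᵐᵒᵖ M] [IsCentralScalar (RepRing k e α) M]
  [IsScalarTower k (RepRing k e α)ᵐᵒᵖ M]
  (d : RepIdx α → RepIdx α → A →ₗ[k] M)
  (hmul : ∀ a b i j, d i j (a * b) =
    ∑ m, (X k e α a i m • d m j b + X k e α b m j • d i m a))
  (hidem : ∀ s i j, d i j (e s) = 0)

/-- The algebra map `f ↦ f + ε ∂f` for the derivation `∂` with `∂ a_{ij} = d i j a`. -/
noncomputable def derivLiftHom : RepRing k e α →ₐ[k] TrivSqZeroExt (RepRing k e α) M :=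
  lift k e α
    (fun a => Matrix.of fun i j => TrivSqZeroExt.inl (X k e α a i j) + TrivSqZeroExt.inr (d i j a))
    (fun a b => by
      ext i j <;> simp [X_add])
    (fun r a => by
      ext i j <;> simp [X_smul])
    (fun a b => by
      ext i j
      · simp [X_mul, Matrix.mul_apply, TrivSqZeroExt.fst_sum]
      · simp [Matrix.mul_apply, TrivSqZeroExt.snd_sum, hmul])
    (fun s => by
      ext i j
      · simp only [X_idem, blockId, Matrix.diagonal_apply, Matrix.of_apply]
        split_ifs <;> simp
      · simp only [hidem, blockId, Matrix.diagonal_apply, Matrix.of_apply]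
        split_ifs <;> simp)

theorem derivLiftHom_X (a : A) (i j : RepIdx α) :
    derivLiftHom d hmul hidem (X k e α a i j) =
      TrivSqZeroExt.inl (X k e α a i j) + TrivSqZeroExt.inr (d i j a) :=
  lift_X ..

/-- Being a section of the projection to R is what makes the ε-component a derivation. -/
theorem fst_derivLiftHom (f : RepRing k e α) : (derivLiftHom d hmul hidem f).fst = f := by
  have : (TrivSqZeroExt.fstHom k (RepRing k e α) M).comp (derivLiftHom d hmul hidem) =
      AlgHom.id k _ := algHom_ext fun a i j => by
    simp [derivLiftHom_X]
  exact DFunLike.congr_fun this f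

/-- The derivation `∂` with `∂ a_{ij} = d i j a`. -/
noncomputable def derivLift : Derivation k (RepRing k e α) M :=
  Derivation.mk' (TrivSqZeroExt.sndHom (RepRing k e α) M ∘ₗ
      (derivLiftHom d hmul hidem).toLinearMap) (by
    intro f g
    simp [fst_derivLiftHom])

theorem derivLift_apply (f : RepRing k e α) :
    derivLift d hmul hidem f = (derivLiftHom d hmul hidem f).snd := rfl

theorem derivLift_X (a : A) (i j : RepIdx α) :
    derivLift d hmul hidem (X k e α a i j) = d i j a := by
  simp [derivLift_apply, derivLiftHom_X]

end Derivations

end RepRing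

/-! ### The bracket on the coordinate ring: existence and uniqueness. -/

namespace DoubleBracket

open RepRing

variable {k : Type*} [Field k] {A : Type*} [Ring A] [Algebra k A]
  {I : Type*} [Fintype I] [DecidableEq I] {e : I → A} {α : I → ℕ}

theorem entry₂_comm (i j u v : RepIdx α) (t : A ⊗[k] A) :
    entry₂ k e α i j u v (TensorProduct.comm k A A t) = entry₂ k e α u v i j t := by
  induction t with
  | zero => simp
  | add x y hx hy => simp only [map_add, hx, hy]
  | tmul x y => simp [entry₂_tmul, mul_comm]

theorem entry₂_lTensor_mulRight (i j u v : RepIdx α) (c : A) (t : A ⊗[k] A) :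
    entry₂ k e α i j u v (LinearMap.lTensor A (LinearMap.mulRight k c) t) =
      ∑ m, entry₂ k e α i j u m t * X k e α c m v := by
  induction t with
  | zero => simp
  | add x y hx hy => simp only [map_add, hx, hy, add_mul, Finset.sum_add_distrib]
  | tmul x y =>
    simp [entry₂_tmul, X_mul, Matrix.mul_apply, Finset.mul_sum, mul_assoc]

theorem entry₂_rTensor_mulLeft (i j u v : RepIdx α) (b : A) (t : A ⊗[k] A) :
    entry₂ k e α i j u v (LinearMap.rTensor A (LinearMap.mulLeft k b) t) =
      ∑ m, X k e α b i m * entry₂ k e α m j u v t := by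
  induction t with
  | zero => simp
  | add x y hx hy => simp only [map_add, hx, hy, mul_add, Finset.sum_add_distrib]
  | tmul x y =>
    simp [entry₂_tmul, X_mul, Matrix.mul_apply, Finset.sum_mul, mul_assoc]

variable (D : DoubleBracket k A e)

theorem entry₂_br_antisymm (a b : A) (i j u v : RepIdx α) :
    entry₂ k e α u j i v (D.br a b) = -entry₂ k e α i v u j (D.br b a) := by
  rw [D.antisymm, map_neg, entry₂_comm]

theorem entry₂_br_mul (a b c : A) (i j u v : RepIdx α) :
    entry₂ k e α u j i v (D.br a (b * c)) =
      ∑ m, (X k e α b u m * entry₂ k e α m j i v (D.br a c) +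
        X k e α c m v * entry₂ k e α u j i m (D.br a b)) := by
  rw [D.leibniz, map_add, entry₂_lTensor_mulRight, entry₂_rTensor_mulLeft, add_comm,
    Finset.sum_add_distrib]
  simp only [mul_comm]

variable (α) in
/-- The derivation `{a_{ij}, -}` of `O(Rep(A, α))`. -/
noncomputable def hamiltonian (i j : RepIdx α) (a : A) :
    Derivation k (RepRing k e α) (RepRing k e α) :=
  derivLift (fun u v => entry₂ k e α u j i v ∘ₗ D.br a)
    (fun b c u v => by simpa using D.entry₂_br_mul a b c i j u v)
    (fun s u v => by simp [D.idem_right])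

theorem hamiltonian_X (a b : A) (i j u v : RepIdx α) :
    D.hamiltonian α i j a (X k e α b u v) = entry₂ k e α u j i v (D.br a b) := by
  simp [hamiltonian, derivLift_X]

variable (α) in
/-- The derivation `f ↦ {f, -}` from `O(Rep(A, α))` to its derivations. -/
noncomputable def repDerivation : Derivation k (RepRing k e α)
    (Derivation k (RepRing k e α) (RepRing k e α)) :=
  derivLift
    (fun i j =>
      { toFun := D.hamiltonian α i j
        map_add' := fun a b => derivation_ext fun c u v => by simp [hamiltonian_X]
        map_smul' := fun r a => derivation_ext fun c u v => by simp [hamiltonian_X] })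
    (fun a b i j => derivation_ext fun c u v => by
      simp only [LinearMap.coe_mk, AddHom.coe_mk, derivation_sum_apply,
        Derivation.add_apply, Derivation.smul_apply, hamiltonian_X, smul_eq_mul]
      -- The double bracket satisfies the Leibniz rule only in its second argument, so antisymmetry
      -- moves the product `a * b` there and back.
      rw [entry₂_br_antisymm, entry₂_br_mul, ← Finset.sum_neg_distrib]
      refine Finset.sum_congr rfl fun m _ => ?_
      rw [D.entry₂_br_antisymm b c, D.entry₂_br_antisymm a c]
      ring)
    (fun s i j => derivation_ext fun c u v => by simp [hamiltonian_X, D.idem_left])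

theorem repDerivation_X (a b : A) (i j u v : RepIdx α) :
    D.repDerivation α (X k e α a i j) (X k e α b u v) = entry₂ k e α u j i v (D.br a b) := by
  simp [repDerivation, derivLift_X, hamiltonian_X]

variable (α) in
/-- The bracket on `O(Rep(A, α))` defined by a double bracket. -/
noncomputable def repBracket : RepRing k e α →ₗ[k] RepRing k e α →ₗ[k] RepRing k e α :=
  LinearMap.mk₂ k (fun f g => D.repDerivation α f g) (by simp) (by simp) (by simp) (by simp)

theorem repBracket_apply (f g : RepRing k e α) :
    D.repBracket α f g = D.repDerivation α f g := rfl

end DoubleBracket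

namespace IsAntisymmBiderivation

variable {k R : Type*} [Field k] [CommRing R] [Algebra k R] {br : R →ₗ[k] R →ₗ[k] R}

/-- The derivation `{f, -}`. -/
noncomputable def derivation (h : IsAntisymmBiderivation br) (f : R) : Derivation k R R :=
  Derivation.mk' (br f) fun g g' => by
    rw [h.leibniz, smul_eq_mul, smul_eq_mul, add_comm, mul_comm g']

theorem derivation_apply (h : IsAntisymmBiderivation br) (f g : R) :
    h.derivation f g = br f g := rfl

theorem leibniz_left (h : IsAntisymmBiderivation br) (f g r : R) :
    br (f * g) r = f * br g r + br f r * g := by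
  rw [h.antisymm, h.leibniz, h.antisymm r f, h.antisymm r g]
  ring

theorem map_algebraMap_right (h : IsAntisymmBiderivation br) (f : R) (r : k) :
    br f (algebraMap k R r) = 0 :=
  (h.derivation f).map_algebraMap r

theorem map_algebraMap_left (h : IsAntisymmBiderivation br) (f : R) (r : k) :
    br (algebraMap k R r) f = 0 := by
  rw [h.antisymm, h.map_algebraMap_right, neg_zero]

end IsAntisymmBiderivation

namespace DoubleBracket

open RepRing

variable {k : Type*} [Field k] {A : Type*} [Ring A] [Algebra k A]
  {I : Type*} [Fintype I] [DecidableEq I] {e : I → A} {α : I → ℕ} (D : DoubleBracket k A e)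

variable (α) in
theorem isRepBracket_repBracket : D.IsRepBracket α (D.repBracket α) where
  antisymm f g := by
    simp only [repBracket_apply]
    induction f using induction_X with
    | hX a i j =>
      induction g using induction_X with
      | hX b u v => rw [repDerivation_X, repDerivation_X, entry₂_br_antisymm]
      | hC r => simp
      | hadd f g hf hg => simp only [map_add, Derivation.add_apply, hf, hg]; ring
      | hmul f g hf hg =>
        simp only [Derivation.leibniz, Derivation.add_apply, Derivation.smul_apply, hf, hg,
          smul_eq_mul]
        ring
    | hC r => simp
    | hadd f g hf hg => simp only [map_add, Derivation.add_apply, hf, hg]; ring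
    | hmul f g hf hg =>
      simp only [Derivation.leibniz, Derivation.add_apply, Derivation.smul_apply, hf, hg,
        smul_eq_mul]
      ring
  leibniz f g h := by
    simp only [repBracket_apply, Derivation.leibniz, smul_eq_mul]
    ring
  apply_X a b i j u v := D.repDerivation_X a b i j u v

variable {D} {br br' : RepRing k e α →ₗ[k] RepRing k e α →ₗ[k] RepRing k e α}

theorem IsRepBracket.eq (h : D.IsRepBracket α br) (h' : D.IsRepBracket α br') : br = br' := by
  refine LinearMap.ext₂ fun f g => ?_
  induction f using induction_X with
  | hX a i j =>
    have : h.derivation (X k e α a i j) = h'.derivation (X k e α a i j) :=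
      derivation_ext fun b u v => (h.apply_X ..).trans (h'.apply_X ..).symm
    exact DFunLike.congr_fun this g
  | hC r => rw [h.map_algebraMap_left, h'.map_algebraMap_left]
  | hadd f₁ f₂ h₁ h₂ => simp only [map_add, LinearMap.add_apply, h₁, h₂]
  | hmul f₁ f₂ h₁ h₂ => rw [h.leibniz_left, h'.leibniz_left, h₁, h₂]

end DoubleBracket

/-! ### Equivariance of the bracket and infinitesimal conjugations. -/

namespace RepRing

variable {k : Type*} [Field k] {A : Type*} [Ring A] [Algebra k A]
  {I : Type*} [Fintype I] [DecidableEq I] {e : I → A} {α : I → ℕ}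

/-- The coefficients lie in k, so a k-bilinear bracket can be expanded through them. That `c` and
`c'` are mutually inverse can be forgotten: in d'_{uj} d''_{iv} the row indices i, u stay rows and
the column indices j, v stay columns, so both sides of the equivariance carry the same coefficients.
-/
theorem glHom_X_eq_sum (g : GLα k α) : ∃ c c' : Matrix (RepIdx α) (RepIdx α) k, ∀ (a : A) (i j),
    glHom k e α g (X k e α a i j) = ∑ p, ∑ q, (c' i p * c q j) • X k e α a p q := by
  refine ⟨Matrix.blockDiagonal' fun s => (g s : Matrix (Fin (α s)) (Fin (α s)) k),
    Matrix.blockDiagonal' fun s => (g⁻¹ s : Matrix (Fin (α s)) (Fin (α s)) k), fun a i j => ?_⟩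
  rw [glHom_X, Matrix.mul_apply, Finset.sum_comm]
  refine Finset.sum_congr rfl fun q _ => ?_
  rw [Matrix.mul_apply, Finset.sum_mul]
  refine Finset.sum_congr rfl fun p _ => ?_
  rw [Algebra.smul_def (A := RepRing k e α), map_mul]
  exact mul_right_comm _ _ _

theorem glHom_repBracket {D : DoubleBracket k A e}
    {br : RepRing k e α →ₗ[k] RepRing k e α →ₗ[k] RepRing k e α} (h : D.IsRepBracket α br)
    (g : GLα k α) (f₁ f₂ : RepRing k e α) :
    glHom k e α g (br f₁ f₂) = br (glHom k e α g f₁) (glHom k e α g f₂) := by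
  induction f₁ using induction_X with
  | hX a i j =>
    induction f₂ using induction_X with
    | hX b u v =>
      obtain ⟨c, c', hc⟩ := glHom_X_eq_sum (e := e) g
      have key (t : A ⊗[k] A) : glHom k e α g (entry₂ k e α u j i v t) =
          ∑ r, ∑ s, ∑ p, ∑ q, (c' u r * c s v * (c' i p * c q j)) • entry₂ k e α r q p s t := by
        induction t with
        | zero => simp
        | add x y hx hy => simp only [map_add, hx, hy, smul_add, Finset.sum_add_distrib]
        | tmul x y =>
          simp only [entry₂_tmul, map_mul, hc, Finset.sum_mul, Finset.mul_sum]
          rw [Finset.sum_comm]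
          refine Eq.trans (Finset.sum_congr rfl fun s _ => ?_) Finset.sum_comm
          rw [Finset.sum_comm]
          refine Finset.sum_congr rfl fun r _ => Finset.sum_congr rfl fun p _ =>
            Finset.sum_congr rfl fun q _ => ?_
          rw [smul_mul_smul_comm]
          congr 1
          ring
      rw [h.apply_X, key, hc, hc]
      simp only [map_sum, map_smul, LinearMap.sum_apply, LinearMap.smul_apply, h.apply_X,
        Finset.smul_sum, smul_smul]
    | hC r => rw [h.map_algebraMap_right, AlgHom.commutes, h.map_algebraMap_right, map_zero]
    | hadd f₁ f₂ h₁ h₂ => simp only [map_add, h₁, h₂]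
    | hmul f₁ f₂ h₁ h₂ => rw [h.leibniz, map_add, map_mul, map_mul, map_mul, h.leibniz, h₁, h₂]
  | hC r => rw [h.map_algebraMap_left, AlgHom.commutes, h.map_algebraMap_left, map_zero]
  | hadd f₁ f₂ h₁ h₂ => simp only [map_add, LinearMap.add_apply, h₁, h₂]
  | hmul f₁ f₂ h₁ h₂ =>
    rw [h.leibniz_left, map_add, map_mul, map_mul, map_mul, h.leibniz_left, h₁, h₂]

section Ad

variable (M : Matrix (RepIdx α) (RepIdx α) (RepRing k e α))

/-- The linear map `a ↦ (X(a) M - M X(a))_{ij}`. -/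
noncomputable def adEntry (i j : RepIdx α) : A →ₗ[k] RepRing k e α where
  toFun a := (X k e α a * M - M * X k e α a) i j
  map_add' a b := by
    rw [X_add, add_mul, mul_add, add_sub_add_comm, Matrix.add_apply]
  map_smul' r a := by
    rw [X_smul, Matrix.mul_smul, Matrix.smul_mul, ← smul_sub, Matrix.smul_apply, RingHom.id_apply]

theorem adEntry_mul (a b : A) (i j : RepIdx α) : adEntry M i j (a * b) =
    ∑ m, (X k e α a i m • adEntry M m j b + X k e α b m j • adEntry M i m a) := by
  have : X k e α (a * b) * M - M * X k e α (a * b) =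
      X k e α a * (X k e α b * M - M * X k e α b) +
        (X k e α a * M - M * X k e α a) * X k e α b := by
    rw [X_mul, mul_sub, sub_mul]; simp only [mul_assoc]; abel
  refine (congrFun₂ this i j).trans ?_
  rw [Matrix.add_apply, Matrix.mul_apply, Matrix.mul_apply, ← Finset.sum_add_distrib]
  simp only [smul_eq_mul, mul_comm, adEntry, LinearMap.coe_mk, AddHom.coe_mk]

theorem adEntry_idem (hM : ∀ s, M * blockId α _ s = blockId α _ s * M)
    (s : I) (i j : RepIdx α) : adEntry M i j (e s) = 0 := by
  simp [adEntry, X_idem, hM]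

/-- The derivation of `O(Rep(A, α))` with `X(a) ↦ X(a) M - M X(a)`. -/
noncomputable def adDerivation (hM : ∀ s, M * blockId α _ s = blockId α _ s * M) :
    Derivation k (RepRing k e α) (RepRing k e α) :=
  derivLift (adEntry M) (adEntry_mul M) (adEntry_idem M hM)

theorem adDerivation_X (hM : ∀ s, M * blockId α _ s = blockId α _ s * M)
    (a : A) (i j : RepIdx α) :
    adDerivation M hM (X k e α a i j) = (X k e α a * M - M * X k e α a) i j :=
  derivLift_X ..

end Ad

end RepRing

namespace RepRing

variable {k : Type*} [Field k] {A : Type*} [Ring A] [Algebra k A]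
  {I : Type*} [Fintype I] [DecidableEq I] {e : I → A} {α : I → ℕ}

/-! ### Conjugation of points over an arbitrary commutative algebra. -/

section Conj

variable {S S' : Type*} [CommRing S] [Algebra k S] [CommRing S'] [Algebra k S']

/-- The composition of an `S`-point `φ` of `Rep(A, α)` with the conjugation by `G ∈ GL_α(S)`,
whose inverse is `G'`. -/
noncomputable def conj (φ : RepRing k e α →ₐ[k] S) (G G' : Matrix (RepIdx α) (RepIdx α) S)
    (h : G * G' = 1) (hG : ∀ s, G * blockId α S s = blockId α S s * G) : RepRing k e α →ₐ[k] S :=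
  lift k e α (fun a => G' * (X k e α a).map φ * G)
    (fun a b => by rw [X_add, Matrix.map_add _ (map_add φ), mul_add, add_mul])
    (fun r a => by
      rw [X_smul, Matrix.map_smul _ _ (fun x => map_smul φ r x), Matrix.mul_smul, Matrix.smul_mul])
    (fun a b => by
      rw [X_mul, Matrix.map_mul]
      calc _ = G' * (X k e α a).map φ * 1 * (X k e α b).map φ * G := by
            simp only [mul_assoc, one_mul]
        _ = _ := by rw [← h]; simp only [mul_assoc])
    (fun s => by
      have : (blockId α (RepRing k e α) s).map φ = blockId α S s := by
        ext i j
        simp only [blockId, Matrix.map_apply, Matrix.diagonal_apply]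
        split_ifs <;> simp
      rw [X_idem, this, mul_assoc, ← hG, ← mul_assoc, mul_eq_one_comm.mp h, one_mul])

theorem conj_X (φ : RepRing k e α →ₐ[k] S) (G G' : Matrix (RepIdx α) (RepIdx α) S)
    (h : G * G' = 1) (hG : ∀ s, G * blockId α S s = blockId α S s * G) (a : A) (i j : RepIdx α) :
    conj φ G G' h hG (X k e α a i j) = (G' * (X k e α a).map φ * G) i j :=
  lift_X ..

theorem comp_conj (ψ : S →ₐ[k] S') (φ : RepRing k e α →ₐ[k] S)
    (G G' : Matrix (RepIdx α) (RepIdx α) S)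
    (h : G * G' = 1) (hG : ∀ s, G * blockId α S s = blockId α S s * G)
    (h' : G.map ψ * G'.map ψ = 1)
    (hG' : ∀ s, G.map ψ * blockId α S' s = blockId α S' s * G.map ψ) :
    ψ.comp (conj φ G G' h hG) = conj (ψ.comp φ) (G.map ψ) (G'.map ψ) h' hG' :=
  algHom_ext fun a i j => by
    rw [AlgHom.comp_apply, conj_X, conj_X, ← Matrix.map_apply (f := ψ), Matrix.map_mul,
      Matrix.map_mul, Matrix.map_map]
    rfl

theorem commute_blockId_iff {G : Matrix (RepIdx α) (RepIdx α) S} :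
    (∀ s, G * blockId α S s = blockId α S s * G) ↔ ∀ i j, i.1 ≠ j.1 → G i j = 0 := by
  simp only [blockId, ← Matrix.ext_iff, Matrix.mul_diagonal, Matrix.diagonal_mul]
  refine ⟨fun h i j hij => ?_, fun h s i j => ?_⟩
  · simpa [hij] using (h j.1 i j)
  · by_cases hij : i.1 = j.1
    · rw [hij, mul_comm]
    · rw [h i j hij, zero_mul, mul_zero]

theorem exists_glMat_eq (G G' : Matrix (RepIdx α) (RepIdx α) k) (h : G * G' = 1)
    (hG : ∀ i j, i.1 ≠ j.1 → G i j = 0) (hG' : ∀ i j, i.1 ≠ j.1 → G' i j = 0) :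
    ∃ g : GLα k α, glMat k e α g = G.map (algebraMap k _) ∧
      glMat k e α g⁻¹ = G'.map (algebraMap k _) := by
  have aux (H : Matrix (RepIdx α) (RepIdx α) k) (hH : ∀ i j, i.1 ≠ j.1 → H i j = 0) :
      Matrix.blockDiagonal' (Matrix.blockDiag' H) = H := by
    ext ⟨s, i⟩ ⟨t, j⟩
    by_cases hst : s = t
    · subst hst
      rw [Matrix.blockDiagonal'_apply_eq, Matrix.blockDiag'_apply]
    · rw [Matrix.blockDiagonal'_apply_ne _ _ _ hst, hH _ _ hst]
  have hs : Matrix.blockDiag' G * Matrix.blockDiag' G' = 1 := by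
    apply Matrix.blockDiagonal'_injective
    rw [Matrix.blockDiagonal'_one, ← h]
    conv_rhs => rw [← aux G hG, ← aux G' hG', ← Matrix.blockDiagonal'_mul]
    rfl
  refine ⟨fun s => ⟨Matrix.blockDiag' G s, Matrix.blockDiag' G' s, congrFun hs s,
    mul_eq_one_comm.mp (congrFun hs s)⟩, ?_, ?_⟩
  · exact congrArg (Matrix.map · (algebraMap k _)) (aux G hG)
  · exact congrArg (Matrix.map · (algebraMap k _)) (aux G' hG')

theorem conj_eq_self_of_mem_invariants {f : RepRing k e α} (hf : f ∈ invariants k e α)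
    (G G' : Matrix (RepIdx α) (RepIdx α) k) (h : G * G' = 1)
    (hG : ∀ i j, i.1 ≠ j.1 → G i j = 0) (hG' : ∀ i j, i.1 ≠ j.1 → G' i j = 0) (h₁ h₂) :
    conj (AlgHom.id k (RepRing k e α)) (G.map (algebraMap k _)) (G'.map (algebraMap k _))
      h₁ h₂ f = f := by
  obtain ⟨g, hg, hg'⟩ := exists_glMat_eq (e := e) G G' h hG hG'
  refine Eq.trans ?_ (hf g)
  refine DFunLike.congr_fun (algHom_ext (g := glHom k e α g) fun a i j => ?_) f
  rw [conj_X, glHom_X, hg, hg']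
  rfl

end Conj

/-! ### A Laurent polynomial is determined by its values on kˣ. -/

section Laurent

open LaurentPolynomial

variable {R S : Type*} [CommRing R] [Algebra k R] [CommRing S] [Algebra k S]

/-- The algebra map `R[T;T⁻¹] → S` which extends `φ` and maps `T` to a unit `x`. -/
noncomputable def laurentEval (φ : R →ₐ[k] S) (x : Sˣ) : R[T;T⁻¹] →ₐ[k] S where
  __ := eval₂ φ.toRingHom x
  commutes' r := by
    change eval₂ φ.toRingHom x (C (algebraMap k R r)) = _
    rw [eval₂_C]
    exact φ.commutes r

theorem laurentEval_T (φ : R →ₐ[k] S) (x : Sˣ) (n : ℤ) :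
    laurentEval φ x (T n) = (x ^ n : Sˣ) := eval₂_T ..

theorem laurentEval_C (φ : R →ₐ[k] S) (x : Sˣ) (r : R) : laurentEval φ x (C r) = φ r := eval₂_C ..

theorem laurentEval_comp_toAlgHom (φ : R →ₐ[k] S) (x : Sˣ) :
    (laurentEval φ x).comp (IsScalarTower.toAlgHom k R R[T;T⁻¹]) = φ :=
  AlgHom.ext (laurentEval_C φ x)

theorem laurentEval_eq_sum (φ : R →ₐ[k] S) (x : Sˣ) (p : R[T;T⁻¹]) :
    laurentEval φ x p = p.coeff.sum fun n r => φ r * (x ^ n : Sˣ) := by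
  induction p using LaurentPolynomial.induction_on' with
  | add p q hp hq =>
    rw [map_add, hp, hq]
    exact (Finsupp.sum_add_index' (fun _ => by rw [map_zero, zero_mul])
      (fun _ _ _ => by rw [map_add, add_mul])).symm
  | C_mul_T n r =>
    rw [map_mul, laurentEval_C, laurentEval_T, ← single_eq_C_mul_T]
    change _ = (Finsupp.single n r).sum fun n r => φ r * ((x ^ n : Sˣ) : S)
    rw [Finsupp.sum_single_index (by rw [map_zero, zero_mul])]

/-- A linear form on R applied to the coefficients gives a vanishing k-combination of the characters
t ↦ tⁿ of kˣ. Distinct characters are independent, and linear forms separate the elements of R. -/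
theorem eq_zero_of_laurentEval_eq_zero [CharZero k] {p : R[T;T⁻¹]}
    (h : ∀ t : kˣ, laurentEval (AlgHom.id k R) (Units.map (algebraMap k R).toMonoidHom t) p = 0) :
    p = 0 := by
  have hchar : Function.Injective fun n : ℤ =>
      (Units.coeHom k).comp (zpowGroupHom (α := kˣ) n) := by
    intro m n hmn
    -- The value at t = 2 already distinguishes the exponents, since ℚ embeds in k.
    have h2 := DFunLike.congr_fun hmn (Units.mk0 (2 : k) two_ne_zero)
    simp only [MonoidHom.comp_apply, zpowGroupHom_apply, Units.coeHom_apply,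
      Units.val_zpow_eq_zpow_val, Units.val_mk0] at h2
    have h3 : ((2 : ℚ) ^ m : ℚ) = 2 ^ n := by
      have : (((2 : ℚ) ^ m : ℚ) : k) = ((2 ^ n : ℚ) : k) := by push_cast; exact h2
      exact_mod_cast this
    exact zpow_right_injective₀ (by norm_num) (by norm_num) h3
  have hli := (linearIndependent_monoidHom kˣ k).comp _ hchar
  ext n
  refine (Module.forall_dual_apply_eq_zero_iff k (p.coeff n)).mp fun l => ?_
  have hl := linearIndependent_iff.mp hli (p.coeff.mapRange l (map_zero l)) (by
    rw [Finsupp.linearCombination_apply, Finsupp.sum_mapRange_index (by simp)]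
    funext t
    have := congrArg l (h t)
    rw [laurentEval_eq_sum, Finsupp.sum, map_sum, map_zero] at this
    rw [Finsupp.sum, Finset.sum_apply, Pi.zero_apply, ← this]
    refine Finset.sum_congr rfl fun m _ => ?_
    rw [← map_zpow, Units.coe_map, AlgHom.id_apply, mul_comm]
    change l (p.coeff m) * _ = l (algebraMap k R (t ^ m : kˣ) * p.coeff m)
    rw [← Algebra.smul_def, map_smul, mul_comm]
    rfl)
  exact DFunLike.congr_fun hl n

end Laurent

end RepRing

/-! ### Infinitesimal conjugations kill invariants. -/

namespace RepRing

variable {k : Type*} [Field k] {A : Type*} [Ring A] [Algebra k A]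
  {I : Type*} [Fintype I] [DecidableEq I] {e : I → A} {α : I → ℕ}

section Elementary

variable {S S' : Type*} [CommRing S] [CommRing S'] {p q : RepIdx α}

/-- The hypothesis treats p = q and p ≠ q together: e_{pq}² is e_{pq} in the first case and 0 in the
second. -/
theorem one_add_single_mul (u w : S) (h : u + w + (if p = q then u * w else 0) = 0) :
    (1 + Matrix.single p q u) * (1 + Matrix.single p q w) = 1 := by
  have : Matrix.single p q u * Matrix.single p q w =
      Matrix.single p q (if p = q then u * w else 0) := by
    split_ifs with hpq
    · subst hpq; exact Matrix.single_mul_single_same ..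
    · rw [Matrix.single_zero]; exact Matrix.single_mul_single_of_ne _ _ _ _ (Ne.symm hpq) _
  rw [mul_add, add_mul, one_mul, mul_one, add_mul, one_mul, this, add_assoc, ← add_assoc,
    ← Matrix.single_add, add_assoc, ← Matrix.single_add, ← add_assoc, h, Matrix.single_zero,
    add_zero]

theorem single_eq_zero_of_ne {I : Type*} [DecidableEq I] {α : I → ℕ} {p q : RepIdx α}
    (hpq : p.1 = q.1) (u : S) (i j : RepIdx α) (hij : i.1 ≠ j.1) :
    Matrix.single p q u i j = 0 :=
  Matrix.single_apply_of_ne _ _ _ _ _ (by rintro ⟨rfl, rfl⟩; exact hij hpq)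

theorem one_add_single_eq_zero_of_ne {I : Type*} [DecidableEq I] {α : I → ℕ} {p q : RepIdx α}
    (hpq : p.1 = q.1) (u : S) (i j : RepIdx α) (hij : i.1 ≠ j.1) :
    (1 + Matrix.single p q u : Matrix _ _ S) i j = 0 := by
  rw [Matrix.add_apply, single_eq_zero_of_ne hpq u i j hij, add_zero,
    Matrix.one_apply_ne (fun h => hij (congrArg _ h))]

theorem one_add_single_map {ι : Type*} [DecidableEq ι] {p q : ι} (φ : S →+* S') (u : S) :
    (1 + Matrix.single p q u : Matrix ι ι S).map φ = 1 + Matrix.single p q (φ u) := by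
  rw [Matrix.map_add _ (map_add φ), Matrix.map_one _ (map_zero φ) (map_one φ), Matrix.map_single]

end Elementary

section Elementary

variable {S S' : Type*} [CommRing S] [Algebra k S] [CommRing S'] [Algebra k S'] {p q : RepIdx α}

/-- The conjugation of an `S`-point of `Rep(A, α)` by the matrix `1 + u e_{pq}`, whose inverse
is `1 + w e_{pq}`. -/
noncomputable def elemConj (hpq : p.1 = q.1) (φ : RepRing k e α →ₐ[k] S) (u w : S)
    (h : u + w + (if p = q then u * w else 0) = 0) : RepRing k e α →ₐ[k] S :=
  conj φ (1 + Matrix.single p q u) (1 + Matrix.single p q w) (one_add_single_mul u w h)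
    (commute_blockId_iff.mpr (one_add_single_eq_zero_of_ne hpq u))

/-- Naturality in the base, used to specialise the single conjugation over R[T;T⁻¹] both at T = t in
kˣ and at T = 1 + ε. -/
theorem comp_elemConj (hpq : p.1 = q.1) (ψ : S →ₐ[k] S') (φ : RepRing k e α →ₐ[k] S) (u w : S)
    (h : u + w + (if p = q then u * w else 0) = 0)
    (φ' : RepRing k e α →ₐ[k] S') (u' w' : S')
    (h' : u' + w' + (if p = q then u' * w' else 0) = 0)
    (hφ : ψ.comp φ = φ') (hu : ψ u = u') (hw : ψ w = w') :
    ψ.comp (elemConj hpq φ u w h) = elemConj hpq φ' u' w' h' := by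
  subst hφ hu hw
  have hm (u : S) : (1 + Matrix.single p q u).map ψ = 1 + Matrix.single p q (ψ u) :=
    one_add_single_map ψ.toRingHom u
  rw [elemConj, comp_conj]
  · simp only [hm]
    rfl
  · simp only [hm]
    exact one_add_single_mul _ _ h'
  · simp only [hm]
    exact commute_blockId_iff.mpr (one_add_single_eq_zero_of_ne hpq _)

theorem elemConj_eq_self_of_mem_invariants (hpq : p.1 = q.1) {f : RepRing k e α}
    (hf : f ∈ invariants k e α) (u w : k) (h : u + w + (if p = q then u * w else 0) = 0) (h') :
    elemConj hpq (AlgHom.id k (RepRing k e α)) (algebraMap k _ u) (algebraMap k _ w) h' f = f := by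
  have := conj_eq_self_of_mem_invariants hf (1 + Matrix.single p q u) (1 + Matrix.single p q w)
    (one_add_single_mul u w h) (one_add_single_eq_zero_of_ne hpq u)
    (one_add_single_eq_zero_of_ne hpq w) (by
      rw [one_add_single_map, one_add_single_map]
      exact one_add_single_mul _ _ h')
    (by
      rw [one_add_single_map]
      exact commute_blockId_iff.mpr (one_add_single_eq_zero_of_ne hpq _))
  simpa only [elemConj, one_add_single_map] using this

open LaurentPolynomial TrivSqZeroExt

/-- Both sides agree at every t in kˣ by invariance under GL_α, hence as Laurent polynomials. The
value of `w` makes 1 + w e_{pq} the inverse of 1 + (T - 1)e_{pq}: for p = q the latter has T as a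
diagonal entry, which is why T must be invertible. -/
theorem elemConj_T_of_mem_invariants [CharZero k] (hpq : p.1 = q.1) {f : RepRing k e α}
    (hf : f ∈ invariants k e α) (w : (RepRing k e α)[T;T⁻¹])
    (hw : w = if p = q then T (-1) - 1 else 1 - T 1) (h) :
    elemConj hpq (IsScalarTower.toAlgHom k (RepRing k e α) (RepRing k e α)[T;T⁻¹])
      (T 1 - 1) w h f = C f := by
  rw [← sub_eq_zero]
  apply eq_zero_of_laurentEval_eq_zero (k := k)
  intro t
  rw [map_sub, laurentEval_C, sub_eq_zero, AlgHom.id_apply, ← AlgHom.comp_apply]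
  have hw' : ((t : k) - 1) + (if p = q then (t : k)⁻¹ - 1 else 1 - t) +
      (if p = q then ((t : k) - 1) * (if p = q then (t : k)⁻¹ - 1 else 1 - t) else 0) = 0 := by
    have := t.ne_zero
    split_ifs
    · field_simp; ring
    · ring
  have hw'' : algebraMap k (RepRing k e α) ((t : k) - 1) +
      algebraMap k (RepRing k e α) (if p = q then (t : k)⁻¹ - 1 else 1 - t) +
      (if p = q then algebraMap k (RepRing k e α) ((t : k) - 1) *
        algebraMap k (RepRing k e α) (if p = q then (t : k)⁻¹ - 1 else 1 - t) else 0) = 0 := by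
    have := congrArg (algebraMap k (RepRing k e α)) hw'
    rw [map_add, map_add, map_zero] at this
    rw [← this]
    split_ifs <;> simp
  rw [comp_elemConj hpq _ _ _ _ _ (AlgHom.id k _) _ _ hw'' ?_ ?_ ?_]
  · exact elemConj_eq_self_of_mem_invariants hpq hf _ _ hw' _
  · exact laurentEval_comp_toAlgHom ..
  · rw [map_sub, laurentEval_T, map_one, map_sub, map_one, zpow_one]
    rfl
  · rw [hw]
    split_ifs
    · rw [map_sub, laurentEval_T, map_one, map_sub, map_one, zpow_neg_one, ← map_inv]
      simp
    · rw [map_sub, laurentEval_T, map_one, map_sub, map_one, zpow_one]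
      rfl

/-- The unit `1 + ε` of the dual numbers. -/
def oneAddEps (R : Type*) [CommRing R] : (TrivSqZeroExt R R)ˣ where
  val := 1 + inr 1
  inv := 1 - inr 1
  val_inv := by ext <;> simp
  inv_val := by ext <;> simp

theorem eps_add_neg_eps {R : Type*} [CommRing R] (c : Prop) [Decidable c] :
    (inr 1 : TrivSqZeroExt R R) + -inr 1 + (if c then inr 1 * -inr 1 else 0) = 0 := by
  rw [mul_neg, inr_mul_inr, neg_zero, ite_self, add_zero, add_neg_cancel]

theorem laurentEval_oneAddEps_T {R : Type*} [CommRing R] [Algebra k R] :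
    laurentEval (inlAlgHom k R R) (oneAddEps R) (T 1) = 1 + inr 1 := by
  rw [laurentEval_T, zpow_one]; rfl

theorem laurentEval_oneAddEps_T_neg {R : Type*} [CommRing R] [Algebra k R] :
    laurentEval (inlAlgHom k R R) (oneAddEps R) (T (-1)) = 1 - inr 1 := by
  rw [laurentEval_T, zpow_neg_one]; rfl

/-- With E = e_{pq}, this is (1 - εE) Y (1 + εE) = Y + ε[Y, E], because ε² = 0. -/
theorem conj_eps_apply {ι R : Type*} [Fintype ι] [DecidableEq ι] [CommRing R] (Y : Matrix ι ι R)
    (p q i j : ι) :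
    (((1 + Matrix.single p q (-inr 1)) * Y.map inl * (1 + Matrix.single p q (inr 1)) :
      Matrix ι ι (TrivSqZeroExt R R)) i j) =
      inl (Y i j) + inr ((Y * Matrix.single p q 1 - Matrix.single p q 1 * Y : Matrix ι ι R) i j) := by
  have h₁ : (Matrix.single p q (inr 1) : Matrix ι ι (TrivSqZeroExt R R)) =
      (Matrix.single p q (1 : R)).map inr :=
    (Matrix.map_single p q (1 : R) (inrHom R R)).symm
  have h₂ (Z : Matrix ι ι R) : Y.map inl * Z.map inr =
      ((Y * Z).map inr : Matrix ι ι (TrivSqZeroExt R R)) := by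
    ext i j <;> simp [Matrix.mul_apply, fst_sum, snd_sum, mul_comm]
  have h₃ (Z : Matrix ι ι R) : Z.map inr * Y.map inl =
      ((Z * Y).map inr : Matrix ι ι (TrivSqZeroExt R R)) := by
    ext i j <;> simp [Matrix.mul_apply, fst_sum, snd_sum, mul_comm]
  have h₄ (Z Z' : Matrix ι ι R) :
      Z.map inr * Z'.map inr = (0 : Matrix ι ι (TrivSqZeroExt R R)) := by
    ext i j
    · simp [Matrix.mul_apply]
    · simp [Matrix.mul_apply]
  have h₅ : (Matrix.single p q (-inr 1) : Matrix ι ι (TrivSqZeroExt R R)) =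
      -Matrix.single p q (inr 1) := by
    rw [eq_neg_iff_add_eq_zero, ← Matrix.single_add, neg_add_cancel, Matrix.single_zero]
  rw [h₅, h₁, add_mul, one_mul, neg_mul, h₃, mul_add, mul_one, add_mul, h₂, neg_mul,
    h₄, neg_zero, add_zero]
  simp only [Matrix.add_apply, Matrix.neg_apply, Matrix.map_apply, Matrix.sub_apply, inr_sub]
  ring

theorem commutator_eq_sum {S : Type*} [CommRing S] (M Y : Matrix (RepIdx α) (RepIdx α) S)
    (hM : ∀ s, M * blockId α _ s = blockId α _ s * M) (i j : RepIdx α) :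
    (Y * M - M * Y) i j = ∑ x : {x : RepIdx α × RepIdx α // x.1.1 = x.2.1}, M x.1.1 x.1.2 •
      (Y * Matrix.single x.1.1 x.1.2 1 - Matrix.single x.1.1 x.1.2 1 * Y : Matrix _ _ S) i j := by
  have hM' : M = ∑ x : {x : RepIdx α × RepIdx α // x.1.1 = x.2.1},
      M x.1.1 x.1.2 • (Matrix.single x.1.1 x.1.2 1 : Matrix _ _ S) := by
    ext i j
    rw [Matrix.sum_apply]
    by_cases h : i.1 = j.1
    · rw [Finset.sum_eq_single ⟨(i, j), h⟩]
      · simp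
      · rintro ⟨⟨i', j'⟩, h'⟩ - hne
        rw [Matrix.smul_apply, Matrix.single_apply_of_ne, smul_zero]
        rintro ⟨rfl, rfl⟩
        exact hne rfl
      · simp
    · rw [commute_blockId_iff.mp hM i j h, Finset.sum_eq_zero]
      rintro ⟨⟨i', j'⟩, h'⟩ -
      rw [Matrix.smul_apply, single_eq_zero_of_ne h' _ _ _ h, smul_zero]
  conv_lhs => rw [hM', Matrix.mul_sum, Matrix.sum_mul, ← Finset.sum_sub_distrib, Matrix.sum_apply]
  refine Finset.sum_congr rfl fun x _ => ?_
  rw [Matrix.mul_smul, Matrix.smul_mul, ← smul_sub, Matrix.smul_apply]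

/-- The conjugation of the generic point of `Rep(A, α)` by `1 + ε e_{pq}`. -/
noncomputable def epsConj (hpq : p.1 = q.1) :
    RepRing k e α →ₐ[k] TrivSqZeroExt (RepRing k e α) (RepRing k e α) :=
  elemConj hpq (inlAlgHom k (RepRing k e α) (RepRing k e α))
    (inr 1 : TrivSqZeroExt (RepRing k e α) (RepRing k e α)) (-inr 1) (eps_add_neg_eps _)

theorem epsConj_X (hpq : p.1 = q.1) (a : A) (i j : RepIdx α) :
    epsConj (k := k) (e := e) hpq (X k e α a i j) = inl (X k e α a i j) +
      inr ((X k e α a * Matrix.single p q 1 - Matrix.single p q 1 * X k e α a :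
        Matrix _ _ (RepRing k e α)) i j) :=
  (conj_X ..).trans (conj_eps_apply (X k e α a) p q i j)

theorem epsConj_apply (hpq : p.1 = q.1) (h) (f : RepRing k e α) :
    (epsConj hpq f).fst = f ∧ (epsConj hpq f).snd = adDerivation (Matrix.single p q 1) h f := by
  induction f using induction_X with
  | hX a i j =>
    rw [adDerivation_X, epsConj_X, fst_add, snd_add, fst_inl, snd_inl, fst_inr, snd_inr, add_zero,
      zero_add]
    exact ⟨rfl, rfl⟩
  | hC r =>
    rw [AlgHom.commutes, Derivation.map_algebraMap]
    exact ⟨rfl, rfl⟩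
  | hadd f g hf hg =>
    rw [map_add, fst_add, snd_add, hf.1, hf.2, hg.1, hg.2, map_add]
    exact ⟨rfl, rfl⟩
  | hmul f g hf hg =>
    rw [map_mul, fst_mul, snd_mul, hf.1, hf.2, hg.1, hg.2, Derivation.leibniz, op_smul_eq_smul]
    exact ⟨rfl, rfl⟩

/-- The derivative is the ε-part of the conjugation by 1 + ε e_{pq}, which is the specialisation T =
1 + ε of the Laurent conjugation. The latter sends an invariant f to the constant f, which has no
ε-part. -/
theorem adDerivation_single_of_mem_invariants [CharZero k] (hpq : p.1 = q.1) {f : RepRing k e α}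
    (hf : f ∈ invariants k e α) (h) : adDerivation (Matrix.single p q 1) h f = 0 := by
  have hw : (T 1 - 1) + (if p = q then T (-1) - 1 else 1 - T 1) +
      (if p = q then (T 1 - 1) * (if p = q then T (-1) - 1 else 1 - T 1) else 0) =
        (0 : (RepRing k e α)[T;T⁻¹]) := by
    have hT : (T 1 * T (-1) : (RepRing k e α)[T;T⁻¹]) = 1 := by rw [← T_add]; simp
    split_ifs
    · linear_combination hT
    · ring
  have h₁ := comp_elemConj hpq _ _ _ _ hw _
    (inr 1 : TrivSqZeroExt (RepRing k e α) (RepRing k e α)) (-inr 1) (eps_add_neg_eps _)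
    (laurentEval_comp_toAlgHom (inlAlgHom k _ _) (oneAddEps (RepRing k e α)))
    (by rw [map_sub, laurentEval_oneAddEps_T, map_one, add_sub_cancel_left])
    (by
      split_ifs
      · rw [map_sub, laurentEval_oneAddEps_T_neg, map_one, sub_sub_cancel_left]
      · rw [map_sub, laurentEval_oneAddEps_T, map_one, sub_add_cancel_left])
  have h₂ := epsConj_apply hpq h f
  rw [← h₂.2, epsConj, ← h₁, AlgHom.comp_apply, elemConj_T_of_mem_invariants hpq hf _ rfl, laurentEval_C]
  rfl

/-- The entries of `M` are functions on Rep(A, α), not scalars, but the derivation is R-linear in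
`M`, so the elementary matrices inside the blocks suffice. -/
theorem adDerivation_of_mem_invariants [CharZero k]
    (M : Matrix (RepIdx α) (RepIdx α) (RepRing k e α))
    (hM : ∀ s, M * blockId α _ s = blockId α _ s * M) {f : RepRing k e α}
    (hf : f ∈ invariants k e α) : adDerivation M hM f = 0 := by
  have hs (x : {x : RepIdx α × RepIdx α // x.1.1 = x.2.1}) := commute_blockId_iff.mpr
    (single_eq_zero_of_ne (S := RepRing k e α) x.2 1)
  have : adDerivation M hM = ∑ x : {x : RepIdx α × RepIdx α // x.1.1 = x.2.1},
      M x.1.1 x.1.2 • adDerivation (Matrix.single x.1.1 x.1.2 1) (hs x) := by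
    refine derivation_ext fun a i j => ?_
    rw [derivation_sum_apply, adDerivation_X, commutator_eq_sum M _ hM]
    refine Finset.sum_congr rfl fun x _ => ?_
    exact congrArg (M x.1.1 x.1.2 • ·) (adDerivation_X ..).symm
  rw [this, derivation_sum_apply]
  refine Finset.sum_eq_zero fun x _ => ?_
  exact (congrArg (M x.1.1 x.1.2 • ·) (adDerivation_single_of_mem_invariants x.2 hf _)).trans
    (smul_zero _)

end Elementary

end RepRing

/-! ### The Jacobiator, and entries of threefold tensors. -/

namespace IsAntisymmBiderivation

variable {k R : Type*} [Field k] [CommRing R] [Algebra k R] {br : R →ₗ[k] R →ₗ[k] R}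

/-- The derivation `f ↦ {f, {g, h}} + {g, {h, f}} + {h, {f, g}}`. -/
noncomputable def jacobiator (hbr : IsAntisymmBiderivation br) (g h : R) : Derivation k R R :=
  ⁅hbr.derivation g, hbr.derivation h⁆ - hbr.derivation (br g h)

theorem jacobiator_apply (hbr : IsAntisymmBiderivation br) (f g h : R) :
    hbr.jacobiator g h f = br f (br g h) + br g (br h f) + br h (br f g) := by
  rw [jacobiator, Derivation.sub_apply, Derivation.commutator_apply]
  simp only [derivation_apply]
  rw [hbr.antisymm f (br g h), hbr.antisymm f g, map_neg]
  ring

/-- Cyclic invariance carries the derivation property from one argument to all three, so each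
argument can be reduced to generators in turn. -/
theorem jacobiator_cyc (hbr : IsAntisymmBiderivation br) (f g h : R) :
    hbr.jacobiator g h f = hbr.jacobiator f g h := by
  simp only [jacobiator_apply]
  ring

end IsAntisymmBiderivation

namespace RepRing

variable (k : Type*) [Field k] {A : Type*} [Ring A] [Algebra k A]
  {I : Type*} [Fintype I] [DecidableEq I] (e : I → A) (α : I → ℕ)

/-- The linear map `a' ⊗ a'' ⊗ a''' ↦ a'_{ij} a''_{uv} a'''_{pq}`. -/
noncomputable def entry₃ (i j u v p q : RepIdx α) : (A ⊗[k] A) ⊗[k] A →ₗ[k] RepRing k e α :=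
  LinearMap.mul' k (RepRing k e α) ∘ₗ TensorProduct.map (entry₂ k e α i j u v) (entry k e α p q)

theorem entry₃_tmul (i j u v p q : RepIdx α) (t : A ⊗[k] A) (x : A) :
    entry₃ k e α i j u v p q (t ⊗ₜ x) = entry₂ k e α i j u v t * X k e α x p q := by
  simp [entry₃, entry]

theorem entry₃_cyc (i j u v p q : RepIdx α) (t : (A ⊗[k] A) ⊗[k] A) :
    entry₃ k e α i j u v p q (DoubleBracket.cyc k A t) = entry₃ k e α u v p q i j t := by
  have : entry₃ k e α i j u v p q ∘ₗ DoubleBracket.cyc k A = entry₃ k e α u v p q i j :=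
    TensorProduct.ext_threefold fun x y z => by
      rw [LinearMap.comp_apply, DoubleBracket.cyc_tmul]
      simp only [entry₃_tmul, entry₂_tmul]
      ring
  exact DFunLike.congr_fun this t

end RepRing

/-! ### The quasi-Poisson right-hand side as a matrix commutator. -/

section OuterProduct

variable {ι S : Type*} [CommRing S]

/-- The product of the `v`-th column of `W` and the `p`-th row of `Z`. -/
def Matrix.outer (W Z : Matrix ι ι S) (v p : ι) : Matrix ι ι S :=
  Matrix.of fun y x => W y v * Z p x

theorem Matrix.mul_outer [Fintype ι] (Y W Z : Matrix ι ι S) (v p : ι) :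
    Y * W.outer Z v p = (Y * W).outer Z v p := by
  ext i j
  simp [Matrix.outer, Matrix.mul_apply, Finset.sum_mul, mul_assoc]

theorem Matrix.outer_mul [Fintype ι] (Y W Z : Matrix ι ι S) (v p : ι) :
    W.outer Z v p * Y = W.outer (Z * Y) v p := by
  ext i j
  simp [Matrix.outer, Matrix.mul_apply, Finset.mul_sum, mul_assoc]

/-- The matrix whose commutator with `Y` has the entries of the quasi-Poisson triple bracket. -/
def Matrix.outerSum [Fintype ι] (B C P : Matrix ι ι S) (u v p q : ι) : Matrix ι ι S :=
  (B * P) u q • P.outer (C * P) v p + (P * C) u q • (P * B).outer P v p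
    - P u q • (P * B).outer (C * P) v p - (B * P * C) u q • P.outer P v p

/-- The eight terms are those of the quasi-Poisson identity, in its order, with Y, B, C, P for a, b,
c, e_s. They pair up: each outer product in `outerSum` accounts for one term with a at the right end
of the first tensor factor and one with a at the left end of the second. -/
theorem Matrix.commutator_outerSum [Fintype ι] (Y B C P : Matrix ι ι S) (i j u v p q : ι) :
    (Y * outerSum B C P u v p q - outerSum B C P u v p q * Y) i j =
      (C * P * Y) p j * (P * B) i v * P u q - (C * P * Y) p j * P i v * (B * P) u q
        - (C * P) p j * (Y * P * B) i v * P u q + (C * P) p j * (Y * P) i v * (B * P) u q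
        - (P * Y) p j * (P * B) i v * (P * C) u q + (P * Y) p j * P i v * (B * P * C) u q
        + P p j * (Y * P * B) i v * (P * C) u q - P p j * (Y * P) i v * (B * P * C) u q := by
  rw [mul_assoc Y P B]
  simp only [outerSum, mul_add, mul_sub, add_mul, sub_mul, Matrix.mul_smul, Matrix.smul_mul,
    mul_outer, outer_mul, add_apply, sub_apply, smul_apply]
  simp only [outer, of_apply, smul_eq_mul]
  ring

end OuterProduct

/-! ### The Jacobi identity and the Poisson bracket on invariants. -/

namespace DoubleBracket

open RepRing

variable {k : Type*} [Field k] {A : Type*} [Ring A] [Algebra k A]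
  {I : Type*} [Fintype I] [DecidableEq I] {e : I → A} {α : I → ℕ} {D : DoubleBracket k A e}
  {br : RepRing k e α →ₗ[k] RepRing k e α →ₗ[k] RepRing k e α}

/-- The Leibniz rule brackets a with either tensor factor of `t`, while `nested` only reaches the
first; hence the flip in the second term. -/
theorem IsRepBracket.br_X_entry₂ (h : D.IsRepBracket α br) (a : A) (i j u v p q : RepIdx α)
    (t : A ⊗[k] A) : br (X k e α a i j) (entry₂ k e α p v u q t) =
      entry₃ k e α p j i v u q (D.nested a t) +
        entry₃ k e α u j i q p v (D.nested a (TensorProduct.comm k A A t)) := by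
  induction t with
  | zero => simp
  | add x y hx hy => simp only [map_add, hx, hy]; ring
  | tmul x y =>
    rw [entry₂_tmul, h.leibniz, h.apply_X, h.apply_X, TensorProduct.comm_tmul, nested,
      LinearMap.rTensor_tmul, LinearMap.rTensor_tmul, entry₃_tmul, entry₃_tmul,
      mul_comm (X k e α x p v)]

theorem IsRepBracket.br_br_X (h : D.IsRepBracket α br) (a b c : A) (i j u v p q : RepIdx α) :
    br (X k e α a i j) (br (X k e α b u v) (X k e α c p q)) =
      entry₃ k e α p j i v u q (D.nested a (D.br b c)) -
        entry₃ k e α u j i q p v (D.nested a (D.br c b)) := by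
  rw [h.apply_X, h.br_X_entry₂, D.antisymm c b, map_neg, map_neg, sub_neg_eq_add]

theorem entry₃_triple (a b c : A) (i j u v p q : RepIdx α) :
    entry₃ k e α p j i v u q (D.triple a b c) =
      entry₃ k e α p j i v u q (D.nested a (D.br b c)) +
      entry₃ k e α i v u q p j (D.nested b (D.br c a)) +
      entry₃ k e α u q p j i v (D.nested c (D.br a b)) := by
  rw [triple, map_add, map_add, entry₃_cyc, entry₃_cyc, entry₃_cyc]

/-- Each of the three iterated brackets gives two nested terms. The six regroup into the triple
brackets of the two cyclic orders of a, b, c. -/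
theorem IsRepBracket.jacobiator_X (h : D.IsRepBracket α br) (a b c : A)
    (i j u v p q : RepIdx α) :
    h.jacobiator (X k e α b u v) (X k e α c p q) (X k e α a i j) =
      entry₃ k e α p j i v u q (D.triple a b c) - entry₃ k e α u j i q p v (D.triple a c b) := by
  rw [h.jacobiator_apply, h.br_br_X, h.br_br_X, h.br_br_X, entry₃_triple, entry₃_triple]
  ring

theorem outer_blockId_eq_zero {S : Type*} [CommRing S] {s : I}
    {W Z : Matrix (RepIdx α) (RepIdx α) S}
    (hW : blockId α S s * W = W) (hZ : Z * blockId α S s = Z) (v p i j : RepIdx α)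
    (hij : i.1 ≠ j.1) : W.outer Z v p i j = 0 := by
  rw [← hW, ← hZ]
  simp only [Matrix.outer, Matrix.of_apply, blockId, Matrix.diagonal_mul, Matrix.mul_diagonal]
  by_cases hi : i.1 = s
  · rw [if_neg (c := j.1 = s) (fun hj => hij (hi.trans hj.symm)), mul_zero, mul_zero]
  · rw [if_neg hi, zero_mul, zero_mul]

theorem blockId_mul_self {S : Type*} [CommRing S] (s : I) :
    blockId α S s * blockId α S s = blockId α S s := by
  rw [blockId, Matrix.diagonal_mul_diagonal]
  congr 1
  funext i
  split_ifs <;> simp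

theorem IsQuasiPoisson.exists_commutator (hD : D.IsQuasiPoisson) (b c : A) (u v p q : RepIdx α) :
    ∃ M : Matrix (RepIdx α) (RepIdx α) (RepRing k e α),
      (∀ s, M * blockId α _ s = blockId α _ s * M) ∧ ∀ a i j,
        entry₃ k e α p j i v u q (D.triple a b c) = (X k e α a * M - M * X k e α a) i j := by
  let B := X k e α b
  let C := X k e α c
  let P := blockId α (RepRing k e α)
  let M (s : I) : Matrix (RepIdx α) (RepIdx α) (RepRing k e α) :=
    Matrix.outerSum B C (P s) u v p q
  refine ⟨(1 / 4 : k) • ∑ s, M s, commute_blockId_iff.mpr fun i j hij => ?_, fun a i j => ?_⟩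
  · rw [Matrix.smul_apply, Matrix.sum_apply, Finset.sum_eq_zero, smul_zero]
    intro s _
    -- In each outer product the column factor begins with P_s and the row factor ends with P_s, so
    -- it is supported in the s-th diagonal block.
    have hP : P s * P s = P s := blockId_mul_self s
    have h₁ : P s * (P s * B) = P s * B := by rw [← mul_assoc, hP]
    have h₂ : C * P s * P s = C * P s := by rw [mul_assoc, hP]
    simp only [M, Matrix.outerSum, Matrix.add_apply, Matrix.sub_apply, Matrix.smul_apply,
      outer_blockId_eq_zero hP hP _ _ _ _ hij, outer_blockId_eq_zero h₁ hP _ _ _ _ hij,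
      outer_blockId_eq_zero hP h₂ _ _ _ _ hij, outer_blockId_eq_zero h₁ h₂ _ _ _ _ hij,
      smul_zero, add_zero, sub_zero]
  · rw [hD, map_smul, map_sum, Matrix.mul_smul, Matrix.smul_mul, ← smul_sub, Matrix.smul_apply,
      Matrix.mul_sum, Matrix.sum_mul, ← Finset.sum_sub_distrib, Matrix.sum_apply]
    congr 1
    refine Finset.sum_congr rfl fun s _ => ?_
    simp only [map_add, map_sub, entry₃_tmul, entry₂_tmul, X_mul, X_idem]
    exact (Matrix.commutator_outerSum (X k e α a) B C (P s) i j u v p q).symm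

/-- One invariant argument is enough: with generators in the other two slots the Jacobiator is a
difference of infinitesimal conjugations applied to f, and those slots are then freed one at a time.
-/
theorem IsRepBracket.jacobi [CharZero k] (h : D.IsRepBracket α br) (hD : D.IsQuasiPoisson)
    {f : RepRing k e α} (hf : f ∈ invariants k e α) (g g' : RepRing k e α) :
    br f (br g g') + br g (br g' f) + br g' (br f g) = 0 := by
  have h₁ (b c : A) (u v p q : RepIdx α) :
      h.jacobiator (X k e α b u v) (X k e α c p q) f = 0 := by
    obtain ⟨M, hM, hM'⟩ := hD.exists_commutator b c u v p q
    -- Exchanging b and c exchanges their index pairs, which gives the index order of the second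
    -- term of `jacobiator_X`.
    obtain ⟨N, hN, hN'⟩ := hD.exists_commutator c b p q u v
    have : h.jacobiator (X k e α b u v) (X k e α c p q) = adDerivation M hM - adDerivation N hN :=
      derivation_ext fun a i j => by
        rw [h.jacobiator_X, Derivation.sub_apply, adDerivation_X, adDerivation_X, hM', hN']
    rw [this, Derivation.sub_apply, adDerivation_of_mem_invariants M hM hf,
      adDerivation_of_mem_invariants N hN hf, sub_zero]
  have h₂ (b : A) (u v : RepIdx α) : h.jacobiator f (X k e α b u v) = 0 :=
    derivation_ext fun c p q => by rw [← h.jacobiator_cyc, h₁]; rfl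
  have h₃ : h.jacobiator g' f = 0 :=
    derivation_ext fun b u v => by rw [h.jacobiator_cyc, h.jacobiator_cyc, h₂]; rfl
  rw [← h.jacobiator_apply, h.jacobiator_cyc, h.jacobiator_cyc, h₃]
  rfl

theorem IsRepBracket.mem_invariants (h : D.IsRepBracket α br) {f g : RepRing k e α}
    (hf : f ∈ invariants k e α) (hg : g ∈ invariants k e α) : br f g ∈ invariants k e α :=
  fun x => (glHom_repBracket h x f g).trans (congrArg₂ (fun f g => br f g) (hf x) (hg x))

/-- The bracket induced on the algebra of invariants. -/
noncomputable def IsRepBracket.invariantBracket (h : D.IsRepBracket α br) :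
    invariants k e α →ₗ[k] invariants k e α →ₗ[k] invariants k e α :=
  LinearMap.mk₂ k (fun f g => ⟨br f g, h.mem_invariants f.2 g.2⟩)
    (fun _ _ _ => Subtype.ext (by simp)) (fun _ _ _ => Subtype.ext (by simp))
    (fun _ _ _ => Subtype.ext (by simp)) (fun _ _ _ => Subtype.ext (by simp))

theorem IsRepBracket.coe_invariantBracket (h : D.IsRepBracket α br) (f g : invariants k e α) :
    (h.invariantBracket f g : RepRing k e α) = br f g := rfl

theorem IsRepBracket.isPoissonBracket_invariantBracket [CharZero k] (h : D.IsRepBracket α br)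
    (hD : D.IsQuasiPoisson) : IsPoissonBracket h.invariantBracket where
  antisymm f g := Subtype.ext (h.antisymm f g)
  leibniz f g g' := Subtype.ext (h.leibniz f g g')
  jacobi f g g' := Subtype.ext (h.jacobi hD f.2 g g')

end DoubleBracket

theorem mainTheorem10 {k : Type*} [Field k] [IsAlgClosed k] [CharZero k]
    {A : Type*} [Ring A] [Algebra k A] [Algebra.FiniteType k A]
    {I : Type*} [Fintype I] [DecidableEq I] (e : I → A) (he : CompleteOrthogonalIdempotents e)
    (D : DoubleBracket k A e) (hD : D.IsQuasiPoisson) (α : I → ℕ) :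
    ∃ br : RepRing k e α →ₗ[k] RepRing k e α →ₗ[k] RepRing k e α,
      D.IsRepBracket α br ∧ (∀ br', D.IsRepBracket α br' → br' = br) ∧
      ∃ P : RepRing.invariants k e α →ₗ[k] RepRing.invariants k e α →ₗ[k]
          RepRing.invariants k e α,
        IsPoissonBracket P ∧
          ∀ f g : RepRing.invariants k e α, (P f g : RepRing k e α) = br f g :=
  have h := D.isRepBracket_repBracket α
  ⟨D.repBracket α, h, fun _ h' => h'.eq h, h.invariantBracket,
    h.isPoissonBracket_invariantBracket hD, h.coe_invariantBracket⟩
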